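/- **Lemma.** Consider a linear time-invariant system $\Sigma$: $\mathcal D x = Ax+Bu$, $y = Cx+Du$ with $x(t)\in\mathcal X=\mathbb R^n$, $u(t)\in\mathcal U=\mathbb R^m$, $y(t)\in\mathbb R^p$, where either $t\in[0,\infty)$ and $\mathcal D x=\dot x$ (continuous time), or $t\in\mathbb N$ and $(\mathcal D x)(t)=x(t+1)$ (discrete time). Let $\mathbb C_g$ be the open left half-plane (continuous time) or the open unit disc (discrete time), and let $\Lambda_g=(-\infty,0)$ or $\Lambda_g=[0,1)$, respectively. Let $P_\Sigma(\lambda)=\begin{bmatrix}A-\lambda I_n&B\\ C&D\end{bmatrix}$; the set $\mathcal Z$ of invariant zeros consists of the $\lambda\in\mathbb C$ at which $\operatorname{rank}P_\Sigma(\lambda)<\max_{\mu\in\mathbb C}\operatorname{rank}P_\Sigma(\mu)$. Assume that $\begin{bmatrix}B\\D\end{bmatrix}$ has linearly independent columns and $[\,C\;\;D\,]$ has linearly independent rows; that $\Sigma$ is right invertible (its transfer matrix $C(sI-A)^{-1}B+D$ has a right inverse over $\mathbb R(s)$) and stabilisable (some $F$ gives $\sigma(A+BF)\subset\mathbb C_g$);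 that $0\notin\mathcal Z$ in continuous time, respectively $1\notin\mathcal Z$ in discrete time; and that every invariant zero in $\mathbb C_g$ has algebraic multiplicity one (as a root of the product of the invariant polynomials in the Smith form of $P_\Sigma$). Let $\mathcal V^\star_g$ be the largest subspace $\mathcal V\subseteq\mathcal X$ for which some $F\in\mathbb R^{m\times n}$ satisfies $(A+BF)\mathcal V\subseteq\mathcal V\subseteq\ker(C+DF)$ and $\sigma(A+BF\,|\,\mathcal V)\subset\mathbb C_g$. For $\lambda\in\mathbb R$ and $j\in\{1,\dots,p\}$ let $$\hat{\mathcal R}_j(\lambda)=\Big\{v\in\mathcal X \;\Big|\; \exists\,\beta\in\mathbb R\setminus\{0\},\ \exists\, w\in\mathcal U:\ P_\Sigma(\lambda)\begin{bmatrix}v\\w\end{bmatrix}=\begin{bmatrix}0\\ \beta e_j\end{bmatrix}\Big\}.$$ Let $\lambda_1,\dots,\lambda_p\in\Lambda_g$. Say that monotonic tracking with visible modes $\lambda_1,\dots,\lambda_p$ is *solvable* if there is $F\in\mathbb R^{m\times n}$ with $\sigma(A+BF)\subset\mathbb C_g$ such that, for every constant reference $r\in\mathbb R^p$, every steady-state pair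 $(x_{ss},u_{ss})$ for $r$ (that is, $r=Cx_{ss}+Du_{ss}$ and $Ax_{ss}+Bu_{ss}$ equals $0$ in continuous time, $x_{ss}$ in discrete time) and every initial state $x(0)$, the law $u=F(x-x_{ss})+u_{ss}$ gives a tracking error $\epsilon=y-r$ with components $\epsilon_k(t)=\beta_k e^{\lambda_k t}$ in continuous time, $\epsilon_k(t)=\beta_k\lambda_k^t$ in discrete time (with $0^0=1$), where the real coefficients $\beta_k$ (possibly zero) depend only on $x(0)-x_{ss}$. Consider the condition $$(\ast)\qquad \text{there are } v_j\in\hat{\mathcal R}_j(\lambda_j)\ (j=1,\dots,p)\ \text{ with }\ \mathcal V^\star_g+\operatorname{span}\{v_1,\dots,v_p\}=\mathcal X .$$ 1. If none of $\lambda_1,\dots,\lambda_p$ is an invariant zero of $\Sigma$, then monotonic tracking with visible modes $\lambda_1,\dots,\lambda_p$ is solvable if and only if $(\ast)$ holds. 2. For arbitrary $\lambda_1,\dots,\lambda_p\in\Lambda_g$, condition $(\ast)$ holds if and only if monotonic tracking with visible modes $\lambda_1,\dots,\lambda_p$ is solvable and all the sets $\hat{\mathcal R}_j(\lambda_j)$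 are non-empty. In particular, $(\ast)$ always implies solvability. -/

import Mathlib

open scoped Polynomial Matrix

/-- The two kinds of time axis: `ℝ⁺ = [0, ∞)` and `ℕ`. -/
inductive TimeDomain
  | continuous
  | discrete

namespace TimeDomain

/-- The stability region `ℂ_g`: the open left half-plane (continuous time) or the open unit disc
(discrete time). -/
def stabRegion : TimeDomain → Set ℂ
  | continuous => {z | z.re < 0}
  | discrete => {z | ‖z‖ < 1}

/-- The set `Λ_g` of admissible visible modes: the negative reals (continuous time) or `[0, 1)`
(discrete time). -/
def visibleModes : TimeDomain → Set ℝ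
  | continuous => Set.Iio 0
  | discrete => Set.Ico 0 1

/-- The frequency of constant signals: `0` in continuous time, `1` in discrete time. -/
def stepFrequency : TimeDomain → ℂ
  | continuous => 0
  | discrete => 1

/-- All eigenvalues (in `ℂ`, i.e. roots of the characteristic polynomial) of the real endomorphism
`f` of a finite-dimensional space lie in `ℂ_g`. -/
def IsAsympStable (τ : TimeDomain) {W : Type*} [AddCommGroup W] [Module ℝ W]
    [Module.Finite ℝ W] (f : Module.End ℝ W) : Prop :=
  f.charpoly.rootSet ℂ ⊆ τ.stabRegion

end TimeDomain

/-- The data of the linear time-invariant system `𝒟x = A x + B u`, `y = C x + D u`, with state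
space `ℝⁿ`, input space `ℝᵐ` and output space `ℝᵖ`. -/
structure LTISystem (n m p : ℕ) where
  A : Matrix (Fin n) (Fin n) ℝ
  B : Matrix (Fin n) (Fin m) ℝ
  C : Matrix (Fin p) (Fin n) ℝ
  D : Matrix (Fin p) (Fin m) ℝ

/-- `d 0 ∣ d 1 ∣ …` (monic) are the non-zero diagonal entries of the Smith form of the polynomial
matrix `P`: there are unimodular `U`, `V` such that `U P V` has the `d i` in the first `r`
diagonal positions and zeros elsewhere. -/
def IsSmithForm {k l : ℕ} (P : Matrix (Fin k) (Fin l) ℂ[X]) (r : ℕ) (d : Fin r → ℂ[X]) : Prop :=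
  r ≤ k ∧ r ≤ l ∧ (∀ i, (d i).Monic) ∧ (∀ i j, i ≤ j → d i ∣ d j) ∧
    ∃ (U : Matrix (Fin k) (Fin k) ℂ[X]) (V : Matrix (Fin l) (Fin l) ℂ[X]),
      IsUnit U ∧ IsUnit V ∧
        U * P * V = Matrix.of fun i j =>
          if h : i.val = j.val ∧ i.val < r then d ⟨i.val, h.2⟩ else 0

namespace LTISystem

variable {n m p : ℕ}

/-- The Rosenbrock system matrix `P_Σ(s) = [A - s I, B; C, D]`, evaluated at an element `s` of a
commutative `ℝ`-algebra (real or complex numbers, or the indeterminate of a polynomial ring). -/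
def rosenbrock (S : LTISystem n m p) {K : Type*} [CommRing K] [Algebra ℝ K] (s : K) :
    Matrix (Fin n ⊕ Fin p) (Fin n ⊕ Fin m) K :=
  Matrix.fromBlocks (S.A.map (algebraMap ℝ K) - s • (1 : Matrix (Fin n) (Fin n) K))
    (S.B.map (algebraMap ℝ K)) (S.C.map (algebraMap ℝ K)) (S.D.map (algebraMap ℝ K))

/-- The normal rank of the Rosenbrock pencil: the maximum of `rank P_Σ(z)` over `z ∈ ℂ`. -/
noncomputable def normalRank (S : LTISystem n m p) : ℕ :=
  ⨆ z : ℂ, (S.rosenbrock z).rank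

/-- The set `𝒵` of invariant zeros: the complex numbers at which `P_Σ` loses rank. -/
def invariantZeros (S : LTISystem n m p) : Set ℂ :=
  {z | (S.rosenbrock z).rank < S.normalRank}

/-- `z` has algebraic multiplicity `k`: it is a root of multiplicity `k` of the product of the
invariant polynomials (the non-zero diagonal entries of the Smith form) of `P_Σ`. -/
def HasAlgMultiplicity (S : LTISystem n m p) (z : ℂ) (k : ℕ) : Prop :=
  ∃ (r : ℕ) (d : Fin r → ℂ[X]),
    IsSmithForm
      (Matrix.reindex finSumFinEquiv finSumFinEquiv (S.rosenbrock (Polynomial.X : ℂ[X]))) r d ∧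
    (∏ i, d i).rootMultiplicity z = k

/-- No coincident minimum-phase invariant zeros. -/
def NoCoincidentMinPhaseZeros (S : LTISystem n m p) (τ : TimeDomain) : Prop :=
  ∀ z ∈ S.invariantZeros ∩ τ.stabRegion, S.HasAlgMultiplicity z 1

/-- The transfer function matrix `C (s I - A)⁻¹ B + D` over the field `ℝ(s)`. -/
noncomputable def transferMatrix (S : LTISystem n m p) : Matrix (Fin p) (Fin m) (RatFunc ℝ) :=
  S.C.map (algebraMap ℝ (RatFunc ℝ)) *
      ((RatFunc.X : RatFunc ℝ) • (1 : Matrix (Fin n) (Fin n) (RatFunc ℝ)) -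
        S.A.map (algebraMap ℝ (RatFunc ℝ)))⁻¹ *
      S.B.map (algebraMap ℝ (RatFunc ℝ)) +
    S.D.map (algebraMap ℝ (RatFunc ℝ))

/-- Right invertibility: the transfer function matrix has a right inverse over `ℝ(s)`. -/
def IsRightInvertible (S : LTISystem n m p) : Prop :=
  ∃ H : Matrix (Fin m) (Fin p) (RatFunc ℝ), S.transferMatrix * H = 1

/-- The closed-loop state map `A + B F`. -/
def closedLoop (S : LTISystem n m p) (F : Matrix (Fin m) (Fin n) ℝ) :
    Module.End ℝ (Fin n → ℝ) :=
  Matrix.toLin' (S.A + S.B * F)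

/-- The closed-loop output map `C + D F`. -/
def closedLoopOutput (S : LTISystem n m p) (F : Matrix (Fin m) (Fin n) ℝ) :
    (Fin n → ℝ) →ₗ[ℝ] (Fin p → ℝ) :=
  Matrix.toLin' (S.C + S.D * F)

/-- Stabilisability: some state feedback makes `A + B F` asymptotically stable. -/
def IsStabilisable (S : LTISystem n m p) (τ : TimeDomain) : Prop :=
  ∃ F, τ.IsAsympStable (S.closedLoop F)

/-- `V` is a stabilisability output-nulling subspace: for some `F`,
`(A + B F) V ⊆ V ⊆ ker (C + D F)` and `σ(A + B F | V) ⊆ ℂ_g`. -/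
def IsStabOutputNulling (S : LTISystem n m p) (τ : TimeDomain)
    (V : Submodule ℝ (Fin n → ℝ)) : Prop :=
  ∃ F, ∃ hinv : ∀ x ∈ V, S.closedLoop F x ∈ V,
    V ≤ LinearMap.ker (S.closedLoopOutput F) ∧
      τ.IsAsympStable ((S.closedLoop F).restrict hinv)

/-- `𝒱*_g`: the largest stabilisability output-nulling subspace, i.e. the supremum of all of
them. -/
def supStabOutputNulling (S : LTISystem n m p) (τ : TimeDomain) :
    Submodule ℝ (Fin n → ℝ) :=
  sSup {V | S.IsStabOutputNulling τ V}

/-- The set `R̂_j(l)` of the states `v` such that `P_Σ(l) [v; w] = [0; β e_j]` for some input `w`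
and some real `β ≠ 0`. -/
def rHat (S : LTISystem n m p) (j : Fin p) (l : ℝ) : Set (Fin n → ℝ) :=
  {v | ∃ β : ℝ, β ≠ 0 ∧ ∃ w : Fin m → ℝ,
    S.rosenbrock l *ᵥ Sum.elim v w = Sum.elim (0 : Fin n → ℝ) (Pi.single j β)}

/-- `(xss, uss)` is a steady-state pair for the constant reference `r`. -/
def IsSteadyState (S : LTISystem n m p) (τ : TimeDomain) (r : Fin p → ℝ)
    (xss : Fin n → ℝ) (uss : Fin m → ℝ) : Prop :=
  (match τ with
    | .continuous => 0 = S.A *ᵥ xss + S.B *ᵥ uss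
    | .discrete => xss = S.A *ᵥ xss + S.B *ᵥ uss) ∧
  r = S.C *ᵥ xss + S.D *ᵥ uss

/-- The value `F (x - xss) + uss` of the tracking control law in the state `x`. -/
def trackingInput (F : Matrix (Fin m) (Fin n) ℝ) (xss : Fin n → ℝ) (uss : Fin m → ℝ)
    (x : Fin n → ℝ) : Fin m → ℝ :=
  F *ᵥ (x - xss) + uss

/-- The feedback matrix `F` solves the tracking problem with prescribed visible modes `l`: the
closed loop is asymptotically stable, and for all step references `r` (with any steady-state pair)
and all initial conditions the tracking error `ε = y - r` under `u = F (x - xss) + uss` is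
`ε_k(t) = β_k exp(l_k t)`, respectively `ε_k(t) = β_k l_k ^ t`, where the real coefficients `β_k`
depend only on the initial error state `ξ(0) = x(0) - xss`. -/
def SolvesMonotonicTracking (S : LTISystem n m p) (τ : TimeDomain) (l : Fin p → ℝ)
    (F : Matrix (Fin m) (Fin n) ℝ) : Prop :=
  τ.IsAsympStable (S.closedLoop F) ∧
  ∃ β : (Fin n → ℝ) → (Fin p → ℝ),
    ∀ (r : Fin p → ℝ) (xss : Fin n → ℝ) (uss : Fin m → ℝ), S.IsSteadyState τ r xss uss →
      match τ with
      | .continuous =>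
        ∀ x : ℝ → (Fin n → ℝ),
          (∀ t, 0 ≤ t → HasDerivWithinAt x
            (S.A *ᵥ x t + S.B *ᵥ trackingInput F xss uss (x t)) (Set.Ici 0) t) →
          ∀ t, 0 ≤ t → ∀ k,
            (S.C *ᵥ x t + S.D *ᵥ trackingInput F xss uss (x t) - r) k =
              β (x 0 - xss) k * Real.exp (l k * t)
      | .discrete =>
        ∀ x : ℕ → (Fin n → ℝ),
          (∀ t, x (t + 1) = S.A *ᵥ x t + S.B *ᵥ trackingInput F xss uss (x t)) →
          ∀ t, ∀ k,
            (S.C *ᵥ x t + S.D *ᵥ trackingInput F xss uss (x t) - r) k =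
              β (x 0 - xss) k * l k ^ t

/-- The structural condition: vectors `v_j ∈ R̂_j(l_j)` exist with
`𝒱*_g + span {v_1, …, v_p} = ℝⁿ`. -/
def HasSpanningModes (S : LTISystem n m p) (τ : TimeDomain) (l : Fin p → ℝ) : Prop :=
  ∃ v : Fin p → (Fin n → ℝ), (∀ j, v j ∈ S.rHat j (l j)) ∧
    S.supStabOutputNulling τ ⊔ Submodule.span ℝ (Set.range v) = ⊤

end LTISystem

/-- `x + i y ≠ 0` is an eigenvector, for the eigenvalue `z`, of the complexification of `f`. -/
def IsRealEigenpair {W : Type*} [AddCommGroup W] [Module ℝ W] (f : Module.End ℝ W) (z : ℂ)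
    (x y : W) : Prop :=
  (x ≠ 0 ∨ y ≠ 0) ∧ f x = z.re • x - z.im • y ∧ f y = z.im • x + z.re • y

theorem Matrix.re_map_ofReal_mulVec {ι κ : Type*} [Fintype κ] (M : Matrix ι κ ℝ) (v : κ → ℂ)
    (i : ι) : (((M.map (algebraMap ℝ ℂ)) *ᵥ v) i).re = (M *ᵥ fun k => (v k).re) i := by
  simp [Matrix.mulVec, dotProduct]

theorem Matrix.im_map_ofReal_mulVec {ι κ : Type*} [Fintype κ] (M : Matrix ι κ ℝ) (v : κ → ℂ)
    (i : ι) : (((M.map (algebraMap ℝ ℂ)) *ᵥ v) i).im = (M *ᵥ fun k => (v k).im) i := by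
  simp [Matrix.mulVec, dotProduct]

section Stability

variable {W : Type*} [AddCommGroup W] [Module ℝ W] [Module.Finite ℝ W]

theorem mem_rootSet_charpoly_iff_toMatrix {ι : Type*} [Fintype ι] [DecidableEq ι]
    (b : Module.Basis ι ℝ W) (f : Module.End ℝ W) (z : ℂ) :
    z ∈ f.charpoly.rootSet ℂ ↔
      (((LinearMap.toMatrix b b f).map (algebraMap ℝ ℂ)).charpoly).IsRoot z := by
  rw [Polynomial.mem_rootSet, ← LinearMap.charpoly_toMatrix f b, Matrix.charpoly_map,
    Polynomial.IsRoot, Polynomial.eval_map_algebraMap]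
  exact and_iff_right (Matrix.charpoly_monic _).ne_zero

theorem mem_rootSet_charpoly_iff (f : Module.End ℝ W) (z : ℂ) :
    z ∈ f.charpoly.rootSet ℂ ↔ ∃ x y, IsRealEigenpair f z x y := by
  classical
  let b := Module.finBasis ℝ W
  set M := LinearMap.toMatrix b b f with hM
  have hf : ∀ x, b.equivFun (f x) = M *ᵥ b.equivFun x := fun x =>
    (LinearMap.toMatrix_mulVec_repr b b f x).symm
  rw [mem_rootSet_charpoly_iff_toMatrix b, Polynomial.IsRoot, Matrix.eval_charpoly,
    ← Matrix.exists_mulVec_eq_zero_iff]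
  have key : ∀ v : Fin (Module.finrank ℝ W) → ℂ,
      ((Matrix.scalar _ z - M.map (algebraMap ℝ ℂ)) *ᵥ v = 0) ↔
      (M *ᵥ (fun k => (v k).re) = z.re • (fun k => (v k).re) - z.im • (fun k => (v k).im)) ∧
      (M *ᵥ (fun k => (v k).im) = z.im • (fun k => (v k).re) + z.re • (fun k => (v k).im)) := by
    intro v
    rw [Matrix.sub_mulVec, sub_eq_zero, funext_iff, funext_iff, funext_iff, ← forall_and]
    refine forall_congr' fun i => ?_
    rw [Complex.ext_iff, Matrix.re_map_ofReal_mulVec, Matrix.im_map_ofReal_mulVec]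
    simp only [Matrix.scalar_apply, Matrix.mulVec_diagonal, Complex.mul_re, Complex.mul_im,
      Pi.sub_apply, Pi.add_apply, Pi.smul_apply, smul_eq_mul]
    constructor
    · rintro ⟨h1, h2⟩
      exact ⟨h1.symm, by rw [← h2]; ring⟩
    · rintro ⟨h1, h2⟩
      exact ⟨h1.symm, by rw [h2]; ring⟩
  constructor
  · rintro ⟨v, hv, h⟩
    obtain ⟨h1, h2⟩ := (key v).1 h
    refine ⟨b.equivFun.symm fun k => (v k).re, b.equivFun.symm fun k => (v k).im, ?_, ?_, ?_⟩
    · by_contra! hc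
      rw [LinearEquiv.map_eq_zero_iff, LinearEquiv.map_eq_zero_iff] at hc
      exact hv (funext fun k => Complex.ext (congrFun hc.1 k) (congrFun hc.2 k))
    · apply b.equivFun.injective
      rw [hf, map_sub, map_smul, map_smul]
      simpa only [LinearEquiv.apply_symm_apply] using h1
    · apply b.equivFun.injective
      rw [hf, map_add, map_smul, map_smul]
      simpa only [LinearEquiv.apply_symm_apply] using h2
  · rintro ⟨x, y, hxy, h1, h2⟩
    refine ⟨fun k => ⟨b.equivFun x k, b.equivFun y k⟩, fun hc => ?_, (key _).2 ⟨?_, ?_⟩⟩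
    · have hx : b.equivFun x = 0 := funext fun k => congrArg Complex.re (congrFun hc k)
      have hy : b.equivFun y = 0 := funext fun k => congrArg Complex.im (congrFun hc k)
      rw [LinearEquiv.map_eq_zero_iff] at hx hy
      exact hxy.elim (· hx) (· hy)
    · have := congrArg b.equivFun h1
      rwa [hf, map_sub, map_smul, map_smul] at this
    · have := congrArg b.equivFun h2
      rwa [hf, map_add, map_smul, map_smul] at this

theorem TimeDomain.isAsympStable_iff (τ : TimeDomain) (f : Module.End ℝ W) :
    τ.IsAsympStable f ↔ ∀ z x y, IsRealEigenpair f z x y → z ∈ τ.stabRegion := by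
  unfold TimeDomain.IsAsympStable
  constructor
  · exact fun h z x y hxy => h ((mem_rootSet_charpoly_iff f z).2 ⟨x, y, hxy⟩)
  · intro h z hz
    obtain ⟨x, y, hxy⟩ := (mem_rootSet_charpoly_iff f z).1 hz
    exact h z x y hxy

open scoped Matrix.Norms.L2Operator in
theorem Matrix.exists_opNorm_pow_lt_one {ι : Type*} [Fintype ι] [DecidableEq ι]
    (M : Matrix ι ι ℂ) (h : ∀ z ∈ spectrum ℂ M, ‖z‖ < 1) : ∃ k : ℕ, ‖M ^ k‖ < 1 := by
  cases isEmpty_or_nonempty ι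
  · refine ⟨0, ?_⟩
    rw [Subsingleton.elim (M ^ 0) 0, norm_zero]
    exact one_pos
  have hr : spectralRadius ℂ M < 1 := by
    have := spectrum.spectralRadius_lt_of_forall_lt M (r := 1) fun z hz => by
      exact_mod_cast h z hz
    simpa using this
  have hev := (spectrum.pow_nnnorm_pow_one_div_tendsto_nhds_spectralRadius M).eventually
    (gt_mem_nhds hr)
  obtain ⟨k, hk, hk0⟩ := (hev.and (Filter.eventually_gt_atTop 0)).exists
  refine ⟨k, ?_⟩
  by_contra! hc
  have h1 : (1 : ENNReal) ≤ (‖M ^ k‖₊ : ENNReal) := by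
    exact_mod_cast hc
  exact absurd hk (not_lt.2 (ENNReal.one_le_rpow h1 (by positivity)))

/-- Discrete-time Lyapunov theorem. -/
theorem exists_lyapunov_form (f : Module.End ℝ W)
    (hf : TimeDomain.discrete.IsAsympStable f) :
    ∃ Q : LinearMap.BilinForm ℝ W, Q.IsSymm ∧ (∀ x, x ≠ 0 → 0 < Q x x) ∧
      ∀ x, x ≠ 0 → Q (f x) (f x) < Q x x := by
  classical
  let b := Module.finBasis ℝ W
  set M := LinearMap.toMatrix b b f with hM
  obtain ⟨k, hk⟩ := Matrix.exists_opNorm_pow_lt_one (M.map (algebraMap ℝ ℂ)) fun z hz =>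
    hf ((mem_rootSet_charpoly_iff_toMatrix b f z).2 (Matrix.mem_spectrum_iff_isRoot_charpoly.1 hz))
  obtain ⟨q, hq⟩ : ∃ q : LinearMap.BilinForm ℝ W,
      ∀ x y, q x y = b.equivFun x ⬝ᵥ b.equivFun y :=
    ⟨(dotProductBilin ℝ ℝ).compl₁₂ b.equivFun.toLinearMap b.equivFun.toLinearMap,
      fun x y => rfl⟩
  have hqn : ∀ x, q x x = ‖WithLp.toLp 2 (fun i => (b.equivFun x i : ℂ))‖ ^ 2 := by
    intro x
    rw [hq, EuclideanSpace.norm_sq_eq]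
    simp [dotProduct, sq]
  have hqpos : ∀ x, x ≠ 0 → 0 < q x x := by
    intro x hx
    rw [hqn]
    have : WithLp.toLp 2 (fun i => (b.equivFun x i : ℂ)) ≠ 0 := by
      intro hc
      apply hx
      rw [← b.equivFun.map_eq_zero_iff]
      funext i
      have := congrArg (fun w : EuclideanSpace ℂ _ => w i) hc
      simpa using this
    positivity
  have hcontr : ∀ x, x ≠ 0 → q ((f ^ k) x) ((f ^ k) x) < q x x := by
    intro x hx
    have h0 := hqpos x hx
    rw [hqn] at h0 ⊢
    rw [hqn]
    have hv : (WithLp.toLp 2 (fun i => (b.equivFun ((f ^ k) x) i : ℂ))) =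
        (EuclideanSpace.equiv _ ℂ).symm ((M.map (algebraMap ℝ ℂ)) ^ k *ᵥ
          (WithLp.toLp 2 (fun i => (b.equivFun x i : ℂ))).ofLp) := by
      apply (EuclideanSpace.equiv _ ℂ).injective
      funext i
      have h1 : b.equivFun ((f ^ k) x) = M ^ k *ᵥ b.equivFun x := by
        rw [hM, LinearMap.toMatrix_pow]
        exact (LinearMap.toMatrix_mulVec_repr b b (f ^ k) x).symm
      rw [← Matrix.map_pow]
      simp [h1, Matrix.mulVec, dotProduct]
    have hle := Matrix.l2_opNorm_mulVec ((M.map (algebraMap ℝ ℂ)) ^ k)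
      (WithLp.toLp 2 (fun i => (b.equivFun x i : ℂ)))
    rw [← hv] at hle
    have hpos : 0 < ‖WithLp.toLp 2 (fun i => (b.equivFun x i : ℂ))‖ :=
      lt_of_le_of_ne (norm_nonneg _) fun h => by rw [← h] at h0; norm_num at h0
    exact pow_lt_pow_left₀ (by nlinarith) (norm_nonneg _) two_ne_zero
  have hkpos : k ≠ 0 ∨ ∀ x : W, x = 0 := by
    by_contra! hc
    obtain ⟨rfl, x, hx⟩ := hc
    exact lt_irrefl _ (hcontr x hx)
  obtain ⟨Q, hQ⟩ : ∃ Q : LinearMap.BilinForm ℝ W,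
      ∀ x y, Q x y = ∑ i ∈ Finset.range k, q ((f ^ i) x) ((f ^ i) y) :=
    ⟨∑ i ∈ Finset.range k, q.compl₁₂ (f ^ i) (f ^ i), fun x y => by
      simp [LinearMap.sum_apply]⟩
  have hqnn : ∀ x, 0 ≤ q x x := fun x => by rw [hqn]; positivity
  refine ⟨Q, ⟨fun x y => ?_⟩, fun x hx => ?_, fun x hx => ?_⟩
  · simp only [hQ, hq, dotProduct_comm]
  · obtain h | h := hkpos
    · rw [hQ]
      refine lt_of_lt_of_le (hqpos x hx) ?_
      have := Finset.single_le_sum (f := fun i => q ((f ^ i) x) ((f ^ i) x))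
        (fun i _ => hqnn _) (Finset.mem_range.2 (Nat.pos_of_ne_zero h))
      simpa only [pow_zero, Module.End.one_apply] using this
    · exact absurd (h x) hx
  · have h1 := Finset.sum_range_succ (fun i => q ((f ^ i) x) ((f ^ i) x)) k
    rw [Finset.sum_range_succ'] at h1
    have h2 : Q (f x) (f x) = ∑ i ∈ Finset.range k, q ((f ^ (i + 1)) x) ((f ^ (i + 1)) x) := by
      rw [hQ]
      simp [pow_succ]
    have h3 := hcontr x hx
    rw [h2, hQ]
    simp only [pow_zero, Module.End.one_apply] at h1
    linarith

theorem isAsympStable_continuous_iff (f : Module.End ℝ W) :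
    TimeDomain.continuous.IsAsympStable f ↔
      ∃ ε : ℝ, 0 < ε ∧ TimeDomain.discrete.IsAsympStable (1 + ε • f) := by
  constructor
  · intro h
    have hev : ∀ᶠ ε : ℝ in nhdsWithin 0 (Set.Ioi 0), ∀ z ∈ f.charpoly.rootSet ℂ,
        2 * z.re + ε * (z.re ^ 2 + z.im ^ 2) < 0 := by
      rw [Filter.eventually_all_finite (f.charpoly.rootSet_finite ℂ)]
      intro z hz
      have hz : z.re < 0 := h hz
      have hc : Filter.Tendsto (fun ε : ℝ => 2 * z.re + ε * (z.re ^ 2 + z.im ^ 2))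
          (nhdsWithin 0 (Set.Ioi 0)) (nhds (2 * z.re + 0 * (z.re ^ 2 + z.im ^ 2))) :=
        ((by fun_prop : Continuous fun ε : ℝ =>
          2 * z.re + ε * (z.re ^ 2 + z.im ^ 2)).tendsto 0).mono_left nhdsWithin_le_nhds
      exact hc.eventually (gt_mem_nhds (by linarith))
    obtain ⟨ε, hε, hε0 : 0 < ε⟩ := (hev.and self_mem_nhdsWithin).exists
    refine ⟨ε, hε0, (TimeDomain.isAsympStable_iff _ _).2 ?_⟩
    rintro z x y ⟨hxy, h1, h2⟩
    have hz := hε ⟨(z.re - 1) / ε, z.im / ε⟩ ((mem_rootSet_charpoly_iff f _).2 ⟨x, y, hxy, ?_, ?_⟩)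
    · have hz' : ‖z‖ ^ 2 < 1 ^ 2 := by
        rw [← Complex.normSq_eq_norm_sq, Complex.normSq_apply]
        field_simp at hz
        nlinarith
      exact lt_of_pow_lt_pow_left₀ 2 zero_le_one hz'
    · have h1' : ε • f x = (z.re - 1) • x - z.im • y := by
        simp only [LinearMap.add_apply, Module.End.one_apply, LinearMap.smul_apply] at h1
        rw [← eq_sub_iff_add_eq'] at h1
        rw [h1]; module
      rw [← inv_smul_smul₀ hε0.ne' (f x), h1']
      simp only [div_eq_inv_mul]
      module
    · have h1' : ε • f y = z.im • x + (z.re - 1) • y := by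
        simp only [LinearMap.add_apply, Module.End.one_apply, LinearMap.smul_apply] at h2
        rw [← eq_sub_iff_add_eq'] at h2
        rw [h2]; module
      rw [← inv_smul_smul₀ hε0.ne' (f y), h1']
      simp only [div_eq_inv_mul]
      module
  · rintro ⟨ε, hε, h⟩
    rw [TimeDomain.isAsympStable_iff] at h ⊢
    rintro z x y ⟨hxy, h1, h2⟩
    have hz : ‖(⟨1 + ε * z.re, ε * z.im⟩ : ℂ)‖ < 1 := h _ x y ⟨hxy, ?_, ?_⟩
    · have hz' : ‖(⟨1 + ε * z.re, ε * z.im⟩ : ℂ)‖ ^ 2 < 1 ^ 2 :=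
        pow_lt_pow_left₀ hz (norm_nonneg _) two_ne_zero
      rw [← Complex.normSq_eq_norm_sq, Complex.normSq_apply] at hz'
      simp only at hz'
      show z.re < 0
      by_contra! hc
      have := mul_nonneg hε.le hc
      nlinarith [mul_self_nonneg (ε * z.im)]
    · simp only [LinearMap.add_apply, Module.End.one_apply, LinearMap.smul_apply, h1]
      module
    · simp only [LinearMap.add_apply, Module.End.one_apply, LinearMap.smul_apply, h2]
      module

variable {V : Type*} [AddCommGroup V] [Module ℝ V] [Module.Finite ℝ V]

theorem exists_stable_compression_discrete (f : Module.End ℝ W) (T : W →ₗ[ℝ] V)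
    (hT : Function.Surjective T) (hf : TimeDomain.discrete.IsAsympStable f) :
    ∃ s : V →ₗ[ℝ] W, T ∘ₗ s = LinearMap.id ∧
      TimeDomain.discrete.IsAsympStable (T ∘ₗ f ∘ₗ s) := by
  obtain ⟨Q, hsymm, hpos, hdec⟩ := exists_lyapunov_form f hf
  have hc : IsCompl (LinearMap.ker T) (Q.orthogonal (LinearMap.ker T)) := by
    rw [LinearMap.BilinForm.isCompl_orthogonal_iff_disjoint hsymm.isRefl, Submodule.disjoint_def]
    intro x hx hx'
    by_contra h0
    exact (hpos x h0).ne' (hx' x hx)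
  let S := Q.orthogonal (LinearMap.ker T)
  have hinj : Function.Injective (T ∘ₗ S.subtype) := by
    rw [← LinearMap.ker_eq_bot, LinearMap.ker_eq_bot']
    intro x hx
    exact Subtype.ext (Submodule.disjoint_def.1 hc.disjoint x hx x.2)
  have hsurj : Function.Surjective (T ∘ₗ S.subtype) := by
    intro v
    obtain ⟨w, rfl⟩ := hT v
    obtain ⟨a, ha, c, hc', rfl⟩ := Submodule.mem_sup.1
      (hc.sup_eq_top ▸ Submodule.mem_top : w ∈ LinearMap.ker T ⊔ S)
    exact ⟨⟨c, hc'⟩, by simp [LinearMap.mem_ker.1 ha]⟩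
  let e := LinearEquiv.ofBijective _ ⟨hinj, hsurj⟩
  let s : V →ₗ[ℝ] W := S.subtype ∘ₗ e.symm.toLinearMap
  have hTs : ∀ v, T (s v) = v := fun v => e.apply_symm_apply v
  have hsS : ∀ v, s v ∈ S := fun v => (e.symm v).2
  refine ⟨s, LinearMap.ext hTs, (TimeDomain.isAsympStable_iff _ _).2 ?_⟩
  have hs0 : ∀ v, v ≠ 0 → s v ≠ 0 := fun v hv h => hv (by rw [← hTs v, h, map_zero])
  have hle : ∀ v, Q (s (T (f (s v)))) (s (T (f (s v)))) ≤ Q (s v) (s v) ∧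
      (v ≠ 0 → Q (s (T (f (s v)))) (s (T (f (s v)))) < Q (s v) (s v)) := by
    intro v
    set u := f (s v) with hu
    set a := u - s (T u) with ha
    have hak : a ∈ LinearMap.ker T := by
      rw [LinearMap.mem_ker, ha, map_sub, hTs, sub_self]
    have h1 : Q a (s (T u)) = 0 := hsS _ a hak
    have h2 : Q (s (T u)) a = 0 := by rw [← h1]; exact hsymm.eq _ _
    have hd : u = a + s (T u) := by rw [ha]; abel
    have hQ : Q u u = Q a a + Q (s (T u)) (s (T u)) := by
      conv_lhs => rw [hd]
      simp only [map_add, LinearMap.add_apply, h1, h2]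
      ring
    have hann : 0 ≤ Q a a := by
      by_cases h : a = 0
      · simp [h]
      · exact (hpos a h).le
    have hlt : v ≠ 0 → Q u u < Q (s v) (s v) := fun hv => hdec _ (hs0 v hv)
    refine ⟨?_, fun hv => by have := hlt hv; linarith⟩
    by_cases hv : v = 0
    · simp [hu, hv]
    · have := hlt hv; linarith
  rintro z x y ⟨hxy, h1, h2⟩
  have e1 : T (f (s x)) = z.re • x - z.im • y := h1
  have e2 : T (f (s y)) = z.im • x + z.re • y := h2
  have hlt : Q (s (T (f (s x)))) (s (T (f (s x)))) + Q (s (T (f (s y)))) (s (T (f (s y)))) <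
      Q (s x) (s x) + Q (s y) (s y) := by
    obtain h | h := hxy
    · exact add_lt_add_of_lt_of_le ((hle x).2 h) (hle y).1
    · exact add_lt_add_of_le_of_lt (hle x).1 ((hle y).2 h)
  have hnn : 0 < Q (s x) (s x) + Q (s y) (s y) := by
    have hq : ∀ v, 0 ≤ Q (s v) (s v) := fun v => by
      by_cases h : s v = 0
      · simp [h]
      · exact (hpos _ h).le
    obtain h | h := hxy
    · exact add_pos_of_pos_of_nonneg (hpos _ (hs0 _ h)) (hq y)
    · exact add_pos_of_nonneg_of_pos (hq x) (hpos _ (hs0 _ h))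
  rw [e1, e2] at hlt
  simp only [map_add, map_sub, map_smul, LinearMap.add_apply, LinearMap.sub_apply,
    LinearMap.smul_apply, smul_eq_mul] at hlt
  have hz : ‖z‖ ^ 2 < 1 ^ 2 := by
    rw [← Complex.normSq_eq_norm_sq, Complex.normSq_apply]
    by_contra! hc
    nlinarith
  exact lt_of_pow_lt_pow_left₀ 2 zero_le_one hz

/-- A stable endomorphism has a stable compression along any surjection. -/
theorem exists_stable_compression (τ : TimeDomain) (f : Module.End ℝ W) (T : W →ₗ[ℝ] V)
    (hT : Function.Surjective T) (hf : τ.IsAsympStable f) :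
    ∃ s : V →ₗ[ℝ] W, T ∘ₗ s = LinearMap.id ∧ τ.IsAsympStable (T ∘ₗ f ∘ₗ s) := by
  cases τ with
  | discrete => exact exists_stable_compression_discrete f T hT hf
  | continuous =>
    obtain ⟨ε, hε, h⟩ := (isAsympStable_continuous_iff f).1 hf
    obtain ⟨s, hs, h'⟩ := exists_stable_compression_discrete _ T hT h
    refine ⟨s, hs, (isAsympStable_continuous_iff _).2 ⟨ε, hε, ?_⟩⟩
    convert h' using 1
    ext v
    have := LinearMap.congr_fun hs v
    simp only [LinearMap.comp_apply, LinearMap.id_apply] at this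
    simp [this]

end Stability

theorem IsRealEigenpair.map {W Z : Type*} [AddCommGroup W] [Module ℝ W] [AddCommGroup Z]
    [Module ℝ Z] {f : Module.End ℝ W} {g : Module.End ℝ Z} {z : ℂ} {x y : W}
    (h : IsRealEigenpair f z x y) (π : W →ₗ[ℝ] Z) (hπ : ∀ w, π (f w) = g (π w))
    (h0 : π x ≠ 0 ∨ π y ≠ 0) : IsRealEigenpair g z (π x) (π y) := by
  refine ⟨h0, ?_, ?_⟩
  · rw [← hπ, h.2.1, map_sub, map_smul, map_smul]
  · rw [← hπ, h.2.2, map_add, map_smul, map_smul]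

theorem TimeDomain.IsAsympStable.prodMap {τ : TimeDomain} {W Z : Type*} [AddCommGroup W]
    [Module ℝ W] [Module.Finite ℝ W] [AddCommGroup Z] [Module ℝ Z] [Module.Finite ℝ Z]
    {f : Module.End ℝ W} {g : Module.End ℝ Z} (hf : τ.IsAsympStable f)
    (hg : τ.IsAsympStable g) : τ.IsAsympStable (f.prodMap g : Module.End ℝ (W × Z)) := by
  rw [TimeDomain.isAsympStable_iff] at *
  intro z x y h
  by_cases h1 : x.1 ≠ 0 ∨ y.1 ≠ 0
  · exact hf z _ _ (h.map (LinearMap.fst ℝ W Z) (fun _ => rfl) h1)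
  · refine hg z _ _ (h.map (LinearMap.snd ℝ W Z) (fun _ => rfl) ?_)
    by_contra! h2
    push Not at h1
    exact h.1.elim (· (Prod.ext h1.1 h2.1)) (· (Prod.ext h1.2 h2.2))

theorem TimeDomain.visibleModes_subset_stabRegion {τ : TimeDomain} {l : ℝ}
    (h : l ∈ τ.visibleModes) : (l : ℂ) ∈ τ.stabRegion := by
  cases τ with
  | continuous => simpa [TimeDomain.stabRegion, TimeDomain.visibleModes] using h
  | discrete =>
    obtain ⟨h0, h1⟩ : 0 ≤ l ∧ l < 1 := h
    simpa [TimeDomain.stabRegion, abs_of_nonneg h0] using h1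

namespace LTISystem

variable {n m p : ℕ}

theorem closedLoop_apply (S : LTISystem n m p) (F : Matrix (Fin m) (Fin n) ℝ) (x : Fin n → ℝ) :
    S.closedLoop F x = S.A *ᵥ x + S.B *ᵥ (F *ᵥ x) := by
  simp [closedLoop]

theorem closedLoopOutput_apply (S : LTISystem n m p) (F : Matrix (Fin m) (Fin n) ℝ)
    (x : Fin n → ℝ) : S.closedLoopOutput F x = S.C *ᵥ x + S.D *ᵥ (F *ᵥ x) := by
  simp [closedLoopOutput]

/-- The states reached by a stable linear family of output-nulling trajectories form a
stabilisability output-nulling subspace. -/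
theorem isStabOutputNulling_range (S : LTISystem n m p) (τ : TimeDomain) {Z : Type*}
    [AddCommGroup Z] [Module ℝ Z] [Module.Finite ℝ Z] (N : Module.End ℝ Z)
    (T : Z →ₗ[ℝ] (Fin n → ℝ)) (U : Z →ₗ[ℝ] (Fin m → ℝ)) (hN : τ.IsAsympStable N)
    (hA : ∀ z, S.A *ᵥ T z + S.B *ᵥ U z = T (N z)) (hC : ∀ z, S.C *ᵥ T z + S.D *ᵥ U z = 0) :
    S.IsStabOutputNulling τ (LinearMap.range T) := by
  obtain ⟨s, hs, hst⟩ := exists_stable_compression τ N T.rangeRestrict T.surjective_rangeRestrict hN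
  obtain ⟨g, hg⟩ := LinearMap.exists_extend (U ∘ₗ s)
  have hgs : ∀ v : LinearMap.range T, g v = U (s v) := fun v => LinearMap.congr_fun hg v
  have hTs : ∀ v : LinearMap.range T, T (s v) = v := fun v =>
    congrArg Subtype.val (LinearMap.congr_fun hs v)
  have hcl : ∀ v : LinearMap.range T, S.closedLoop (LinearMap.toMatrix' g) v = T (N (s v)) := by
    intro v
    rw [closedLoop_apply, LinearMap.toMatrix'_mulVec, hgs, ← hA, hTs]
  refine ⟨LinearMap.toMatrix' g, fun x hx => ?_, fun x hx => ?_, ?_⟩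
  · rw [hcl ⟨x, hx⟩]
    exact LinearMap.mem_range_self _ _
  · rw [LinearMap.mem_ker, closedLoopOutput_apply, LinearMap.toMatrix'_mulVec, hgs ⟨x, hx⟩,
      ← hC (s ⟨x, hx⟩), hTs]
  · convert hst using 1
    ext v : 2
    exact hcl v

theorem IsStabOutputNulling.sup {S : LTISystem n m p} {τ : TimeDomain}
    {V₁ V₂ : Submodule ℝ (Fin n → ℝ)} (h₁ : S.IsStabOutputNulling τ V₁)
    (h₂ : S.IsStabOutputNulling τ V₂) : S.IsStabOutputNulling τ (V₁ ⊔ V₂) := by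
  obtain ⟨F₁, i₁, k₁, s₁⟩ := h₁
  obtain ⟨F₂, i₂, k₂, s₂⟩ := h₂
  have := S.isStabOutputNulling_range τ _ (V₁.subtype.coprod V₂.subtype)
    ((F₁.mulVecLin ∘ₗ V₁.subtype).coprod (F₂.mulVecLin ∘ₗ V₂.subtype)) (s₁.prodMap s₂) ?_ ?_
  · rwa [LinearMap.range_coprod, Submodule.range_subtype, Submodule.range_subtype] at this
  · rintro ⟨a, b⟩
    simp only [LinearMap.coprod_apply, LinearMap.prodMap_apply, LinearMap.comp_apply,
      Submodule.subtype_apply, LinearMap.coe_restrict_apply, closedLoop_apply, Matrix.mulVec_add,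
      Matrix.mulVecLin_apply]
    abel
  · rintro ⟨a, b⟩
    have e₁ := k₁ a.2
    have e₂ := k₂ b.2
    rw [LinearMap.mem_ker, closedLoopOutput_apply] at e₁ e₂
    simp only [LinearMap.coprod_apply, LinearMap.comp_apply, Submodule.subtype_apply,
      Matrix.mulVec_add, Matrix.mulVecLin_apply]
    rw [add_add_add_comm, e₁, e₂, add_zero]

theorem isStabOutputNulling_supStabOutputNulling (S : LTISystem n m p) (τ : TimeDomain) :
    S.IsStabOutputNulling τ (S.supStabOutputNulling τ) := by
  refine CompleteLattice.WellFoundedGT.isSupClosedCompact _ inferInstance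
    {V | S.IsStabOutputNulling τ V} ⟨⊥, ?_⟩ fun _ h₁ _ h₂ => h₁.sup h₂
  have := S.isStabOutputNulling_range τ (0 : Module.End ℝ (Fin 0 → ℝ)) 0 0 ?_ (by simp) (by simp)
  · rwa [LinearMap.range_zero] at this
  · rw [TimeDomain.isAsympStable_iff]
    rintro z x y ⟨hxy, -⟩
    exact hxy.elim (absurd (Subsingleton.elim _ _)) (absurd (Subsingleton.elim _ _))

theorem mem_rHat_iff (S : LTISystem n m p) (j : Fin p) (l : ℝ) (v : Fin n → ℝ) :
    v ∈ S.rHat j l ↔ ∃ β : ℝ, β ≠ 0 ∧ ∃ w : Fin m → ℝ,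
      S.A *ᵥ v + S.B *ᵥ w = l • v ∧ S.C *ᵥ v + S.D *ᵥ w = Pi.single j β := by
  have hid : ∀ {k k' : ℕ} (M : Matrix (Fin k) (Fin k') ℝ), M.map (algebraMap ℝ ℝ) = M :=
    fun M => rfl
  simp only [rHat, Set.mem_ofPred_eq, rosenbrock, Matrix.fromBlocks_mulVec, hid,
    Sum.elim_comp_inl, Sum.elim_comp_inr, Sum.elim_eq_iff, Matrix.sub_mulVec, Matrix.smul_mulVec,
    Matrix.one_mulVec]
  refine exists_congr fun β => and_congr_right fun _ => exists_congr fun w =>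
    and_congr_left fun _ => ?_
  rw [sub_add_eq_add_sub, sub_eq_zero]

theorem HasSpanningModes.exists_feedback {S : LTISystem n m p} {τ : TimeDomain} {l : Fin p → ℝ}
    (hl : ∀ j, l j ∈ τ.visibleModes) (h : S.HasSpanningModes τ l) :
    ∃ F, τ.IsAsympStable (S.closedLoop F) ∧ ∀ x k,
      S.closedLoopOutput F (S.closedLoop F x) k = l k * S.closedLoopOutput F x k := by
  classical
  obtain ⟨v, hv, hspan⟩ := h
  simp only [mem_rHat_iff] at hv
  choose β _ w hAv hCv using hv
  obtain ⟨F₀, hinv, hker, hst⟩ := S.isStabOutputNulling_supStabOutputNulling τ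
  set V := S.supStabOutputNulling τ
  obtain ⟨κ, a, ha, hsp, hli⟩ := exists_linearIndependent' ℝ (V.mkQ ∘ v)
  have : Finite κ := Finite.of_injective a ha
  have := Fintype.ofFinite κ
  have htop : ⊤ ≤ Submodule.span ℝ (Set.range ((V.mkQ ∘ v) ∘ a)) := by
    rw [hsp, Set.range_comp, ← Submodule.map_span]
    have h1 : Submodule.map V.mkQ (V ⊔ Submodule.span ℝ (Set.range v)) = ⊤ := by
      rw [hspan, Submodule.map_top, Submodule.range_mkQ]
    rw [Submodule.map_sup, Submodule.mkQ_map_self, bot_sup_eq] at h1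
    exact h1.ge
  let b := Module.Basis.mk hli htop
  have hb : ∀ k, b k = V.mkQ (v (a k)) := fun k => Module.Basis.mk_apply hli htop k
  let c : (Fin n → ℝ) →ₗ[ℝ] (κ → ℝ) := b.equivFun.toLinearMap ∘ₗ V.mkQ
  have hcV : ∀ x, c x = 0 ↔ x ∈ V := by
    intro x
    show b.equivFun (V.mkQ x) = 0 ↔ _
    rw [LinearEquiv.map_eq_zero_iff, Submodule.mkQ_apply, Submodule.Quotient.mk_eq_zero]
  have hcv : ∀ k, c (v (a k)) = Pi.single k 1 := by
    intro k
    show b.equivFun (V.mkQ (v (a k))) = _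
    rw [← hb]
    ext i
    rw [Module.Basis.equivFun_self, Pi.single_apply, eq_comm (a := k)]
  let E : (κ → ℝ) →ₗ[ℝ] (Fin n → ℝ) := Fintype.linearCombination ℝ (v ∘ a)
  have hE : ∀ u, E u = ∑ k, u k • v (a k) := fun u => rfl
  have hcE : ∀ u, c (E u) = u := by
    intro u
    simp only [hE, map_sum, map_smul, hcv]
    exact (pi_eq_sum_univ' u).symm
  have hπ : ∀ x, x - E (c x) ∈ V := fun x => by rw [← hcV, map_sub, hcE, sub_self]
  let G : (Fin n → ℝ) →ₗ[ℝ] (Fin m → ℝ) :=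
    F₀.mulVecLin ∘ₗ (LinearMap.id - E ∘ₗ c) + Fintype.linearCombination ℝ (w ∘ a) ∘ₗ c
  have hG : ∀ x, G x = F₀ *ᵥ (x - E (c x)) + ∑ k, c x k • w (a k) := fun x => rfl
  have hcl : ∀ x, S.closedLoop (LinearMap.toMatrix' G) x =
      S.closedLoop F₀ (x - E (c x)) + E fun k => l (a k) * c x k := by
    intro x
    rw [closedLoop_apply, closedLoop_apply, LinearMap.toMatrix'_mulVec, hG, Matrix.mulVec_add,
      Matrix.mulVec_sub S.A, hE (fun k => l (a k) * c x k)]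
    have : ∑ k, (l (a k) * c x k) • v (a k) =
        S.A *ᵥ E (c x) + S.B *ᵥ ∑ k, c x k • w (a k) := by
      simp only [hE, Matrix.mulVec_sum, Matrix.mulVec_smul, ← Finset.sum_add_distrib, ← smul_add,
        hAv]
      simp only [smul_smul, mul_comm]
    rw [this]
    abel
  have hout : ∀ x, S.closedLoopOutput (LinearMap.toMatrix' G) x =
      ∑ k, c x k • (Pi.single (a k) (β (a k)) : Fin p → ℝ) := by
    intro x
    have h0 := hker (hπ x)
    rw [LinearMap.mem_ker, closedLoopOutput_apply, Matrix.mulVec_sub] at h0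
    rw [closedLoopOutput_apply, LinearMap.toMatrix'_mulVec, hG, Matrix.mulVec_add]
    have : ∑ k, c x k • (Pi.single (a k) (β (a k)) : Fin p → ℝ) =
        S.C *ᵥ E (c x) + S.D *ᵥ ∑ k, c x k • w (a k) := by
      simp only [hE, Matrix.mulVec_sum, Matrix.mulVec_smul, ← Finset.sum_add_distrib, ← smul_add,
        hCv]
    rw [this, ← sub_eq_zero, ← h0]
    abel
  have hccl : ∀ x, c (S.closedLoop (LinearMap.toMatrix' G) x) = fun k => l (a k) * c x k := by
    intro x
    rw [hcl, map_add, (hcV _).2 (hinv _ (hπ x)), hcE, zero_add]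
  refine ⟨LinearMap.toMatrix' G, (TimeDomain.isAsympStable_iff _ _).2 ?_, fun x j => ?_⟩
  · rintro z x y hxy
    by_cases h0 : c x = 0 ∧ c y = 0
    · have hr : ∀ x (hx : x ∈ V), S.closedLoop (LinearMap.toMatrix' G) x = S.closedLoop F₀ x := by
        intro x hx
        rw [hcl, (hcV x).2 hx]
        simp [hE]
      have hx := (hcV x).1 h0.1
      have hy := (hcV y).1 h0.2
      refine (TimeDomain.isAsympStable_iff _ _).1 hst z ⟨x, hx⟩ ⟨y, hy⟩ ⟨?_, ?_, ?_⟩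
      · simpa [Subtype.ext_iff] using hxy.1
      · ext1
        rw [LinearMap.coe_restrict_apply, ← hr x hx]
        exact hxy.2.1
      · ext1
        rw [LinearMap.coe_restrict_apply, ← hr y hy]
        exact hxy.2.2
    · have hk : ∃ k, c x k ≠ 0 ∨ c y k ≠ 0 := by
        by_contra! hc
        exact h0 ⟨funext fun k => (hc k).1, funext fun k => (hc k).2⟩
      obtain ⟨k, hk⟩ := hk
      have e1 := congrFun (congrArg c hxy.2.1) k
      have e2 := congrFun (congrArg c hxy.2.2) k
      rw [hccl, map_sub, map_smul, map_smul] at e1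
      rw [hccl, map_add, map_smul, map_smul] at e2
      simp only [Pi.sub_apply, Pi.add_apply, Pi.smul_apply, smul_eq_mul] at e1 e2
      have hs : 0 < c x k ^ 2 + c y k ^ 2 := by
        obtain h | h := hk <;> positivity
      have him : z.im * (c x k ^ 2 + c y k ^ 2) = 0 := by linear_combination c y k * e1 - c x k * e2
      have hre : (l (a k) - z.re) * (c x k ^ 2 + c y k ^ 2) = 0 := by
        linear_combination c x k * e1 + c y k * e2
      have him' := (mul_eq_zero.1 him).resolve_right hs.ne'
      have hre' := (mul_eq_zero.1 hre).resolve_right hs.ne'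
      have : z = (l (a k) : ℂ) := Complex.ext (by simp; linarith) (by simpa using him')
      rw [this]
      exact TimeDomain.visibleModes_subset_stabRegion (hl _)
  · rw [hout, hout, hccl, Finset.sum_apply, Finset.sum_apply, Finset.mul_sum]
    refine Finset.sum_congr rfl fun k _ => ?_
    simp only [Pi.smul_apply, smul_eq_mul, Pi.single_apply]
    split_ifs with h
    · rw [h]; ring
    · simp

theorem hasSpanningModes_of_feedback {S : LTISystem n m p} {τ : TimeDomain} {l : Fin p → ℝ}
    {F : Matrix (Fin m) (Fin n) ℝ} (hF : τ.IsAsympStable (S.closedLoop F))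
    (hCF : ∀ x k, S.closedLoopOutput F (S.closedLoop F x) k = l k * S.closedLoopOutput F x k)
    (hne : ∀ j, (S.rHat j (l j)).Nonempty) : S.HasSpanningModes τ l := by
  choose v hv using hne
  refine ⟨v, hv, ?_⟩
  simp only [mem_rHat_iff] at hv
  choose β hβ w hAv hCv using hv
  let c : (Fin n → ℝ) →ₗ[ℝ] (Fin p → ℝ) :=
    LinearMap.pi fun j => (β j)⁻¹ • LinearMap.proj j ∘ₗ S.closedLoopOutput F
  have hc : ∀ x j, c x j = (β j)⁻¹ * S.closedLoopOutput F x j := fun x j => rfl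
  have hcl : ∀ x j, c (S.closedLoop F x) j = l j * c x j := by
    intro x j
    rw [hc, hc, hCF]; ring
  let T : (Fin n → ℝ) →ₗ[ℝ] (Fin n → ℝ) := LinearMap.id - Fintype.linearCombination ℝ v ∘ₗ c
  let U : (Fin n → ℝ) →ₗ[ℝ] (Fin m → ℝ) := F.mulVecLin - Fintype.linearCombination ℝ w ∘ₗ c
  have hT : ∀ x, T x = x - ∑ j, c x j • v j := fun x => rfl
  have hU : ∀ x, U x = F *ᵥ x - ∑ j, c x j • w j := fun x => rfl
  have hV := S.isStabOutputNulling_range τ (S.closedLoop F) T U hF ?_ ?_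
  · rw [eq_top_iff]
    intro x _
    have hx : x = T x + ∑ j, c x j • v j := by rw [hT, sub_add_cancel]
    rw [hx]
    refine Submodule.add_mem_sup
      ((le_sSup hV : _ ≤ S.supStabOutputNulling τ) ⟨x, rfl⟩)
      (Submodule.sum_mem _ fun j _ => Submodule.smul_mem _ _ (Submodule.subset_span ⟨j, rfl⟩))
  · intro x
    have : ∑ j, c (S.closedLoop F x) j • v j =
        S.A *ᵥ (∑ j, c x j • v j) + S.B *ᵥ ∑ j, c x j • w j := by
      simp only [Matrix.mulVec_sum, Matrix.mulVec_smul, ← Finset.sum_add_distrib, ← smul_add, hAv,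
        hcl, smul_smul, mul_comm]
    rw [hT, hU, hT, this, Matrix.mulVec_sub, Matrix.mulVec_sub, closedLoop_apply]
    abel
  · intro x
    have : S.closedLoopOutput F x =
        S.C *ᵥ (∑ j, c x j • v j) + S.D *ᵥ ∑ j, c x j • w j := by
      simp only [Matrix.mulVec_sum, Matrix.mulVec_smul, ← Finset.sum_add_distrib, ← smul_add, hCv]
      ext k
      simp [Pi.single_apply, hc, hβ, mul_comm]
    rw [closedLoopOutput_apply] at this
    rw [hT, hU, Matrix.mulVec_sub, Matrix.mulVec_sub, sub_add_sub_comm, this, sub_self]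

end LTISystem

namespace LTISystem

variable {n m p : ℕ}

theorem exists_rosenbrock_mul_eq_smul_one (S : LTISystem n m p) (h : S.IsRightInvertible) :
    ∃ (q : ℝ[X]) (H : Matrix (Fin n ⊕ Fin m) (Fin n ⊕ Fin p) ℝ[X]), q ≠ 0 ∧
      S.rosenbrock (Polynomial.X : ℝ[X]) * H = q • 1 := by
  obtain ⟨H, hH⟩ := h
  set A := S.A.map (algebraMap ℝ (RatFunc ℝ)) with hA
  set B := S.B.map (algebraMap ℝ (RatFunc ℝ)) with hB
  set C := S.C.map (algebraMap ℝ (RatFunc ℝ)) with hC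
  set D := S.D.map (algebraMap ℝ (RatFunc ℝ)) with hD
  set N : Matrix (Fin n) (Fin n) (RatFunc ℝ) :=
    (RatFunc.X : RatFunc ℝ) • (1 : Matrix (Fin n) (Fin n) (RatFunc ℝ)) - A with hN
  have hmap : (S.rosenbrock (Polynomial.X : ℝ[X])).map (algebraMap ℝ[X] (RatFunc ℝ)) =
      Matrix.fromBlocks (-N) B C D := by
    ext (i | i) (j | j)
    · by_cases h : i = j <;> simp [rosenbrock, hN, hA, h]
    all_goals simp [rosenbrock, hB, hC, hD]
  have hdet : N.det ≠ 0 := by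
    have : N = (S.A.charmatrix).map (algebraMap ℝ[X] (RatFunc ℝ)) := by
      ext i j
      simp [hN, hA, Matrix.charmatrix_apply, Matrix.one_apply, Matrix.diagonal_apply, apply_ite]
    rw [this, ← RingHom.mapMatrix_apply, ← RingHom.map_det]
    intro h0
    exact (Matrix.charpoly_monic S.A).ne_zero
      ((map_eq_zero_iff _ (RatFunc.algebraMap_injective ℝ)).1 h0)
  have hNR : N * N⁻¹ = 1 := Matrix.mul_nonsing_inv _ (isUnit_iff_ne_zero.2 hdet)
  have hG : C * N⁻¹ * B * H + D * H = 1 := by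
    rw [← Matrix.add_mul]; exact hH
  set K : Matrix (Fin n ⊕ Fin m) (Fin n ⊕ Fin p) (RatFunc ℝ) :=
    Matrix.fromBlocks (N⁻¹ * B * H * C * N⁻¹ - N⁻¹) (N⁻¹ * B * H) (H * C * N⁻¹) H with hK
  have hPK : Matrix.fromBlocks (-N) B C D * K = 1 := by
    have r : ∀ {k : ℕ} (Y : Matrix (Fin n) (Fin k) (RatFunc ℝ)), N * (N⁻¹ * Y) = Y := fun Y => by
      rw [← Matrix.mul_assoc, hNR, Matrix.one_mul]
    rw [hK, Matrix.fromBlocks_multiply, ← Matrix.fromBlocks_one]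
    congr 1
    · simp only [Matrix.neg_mul, Matrix.mul_sub, Matrix.mul_assoc, r, hNR]
      abel
    · simp only [Matrix.neg_mul, Matrix.mul_assoc, r]
      abel
    · have : C * (N⁻¹ * B * H * C * N⁻¹ - N⁻¹) + D * (H * C * N⁻¹) =
          (C * N⁻¹ * B * H + D * H) * (C * N⁻¹) - C * N⁻¹ := by
        simp only [Matrix.mul_sub, Matrix.add_mul, Matrix.mul_assoc]
        abel
      rw [this, hG, Matrix.one_mul, sub_self]
    · rw [← hG]
      simp only [Matrix.mul_assoc]
  obtain ⟨q, hq⟩ := IsLocalization.exist_integer_multiples_of_finite (nonZeroDivisors ℝ[X])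
    (fun ij : (Fin n ⊕ Fin m) × (Fin n ⊕ Fin p) => K ij.1 ij.2)
  choose H' hH' using hq
  refine ⟨q, Matrix.of fun i j => H' (i, j), nonZeroDivisors.coe_ne_zero q, ?_⟩
  have hmapinj : Function.Injective
      fun M : Matrix (Fin n ⊕ Fin p) (Fin n ⊕ Fin p) ℝ[X] =>
        M.map (algebraMap ℝ[X] (RatFunc ℝ)) :=
    Matrix.map_injective (RatFunc.algebraMap_injective ℝ)
  apply hmapinj
  have hH'' : (Matrix.of fun i j => H' (i, j)).map (algebraMap ℝ[X] (RatFunc ℝ)) =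
      (algebraMap ℝ[X] (RatFunc ℝ) q) • K := by
    ext i j
    simp [hH', Algebra.smul_def]
  simp only
  rw [Matrix.map_mul, hmap, hH'', Matrix.mul_smul, hPK]
  ext i j
  by_cases h : i = j <;> simp [h]

theorem rosenbrock_map (S : LTISystem n m p) {K L : Type*} [CommRing K] [Algebra ℝ K]
    [CommRing L] [Algebra ℝ L] (g : K →ₐ[ℝ] L) (s : K) :
    (S.rosenbrock s).map g = S.rosenbrock (g s) := by
  ext (i | i) (j | j)
  · by_cases h : i = j <;> simp [rosenbrock, h]
  all_goals simp [rosenbrock]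

theorem rank_rosenbrock_le (S : LTISystem n m p) (z : ℂ) : (S.rosenbrock z).rank ≤ n + p := by
  simpa using (S.rosenbrock z).rank_le_card_height

theorem le_normalRank (S : LTISystem n m p) (h : S.IsRightInvertible) :
    n + p ≤ S.normalRank := by
  obtain ⟨q, H, hq, hqH⟩ := S.exists_rosenbrock_mul_eq_smul_one h
  obtain ⟨a, ha⟩ : ∃ a : ℝ, q.eval a ≠ 0 := by
    by_contra! hc
    exact hq (Polynomial.funext fun a => by simpa using hc a)
  let g : ℝ[X] →ₐ[ℝ] ℂ := Polynomial.aeval (a : ℂ)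
  have hg : g q ≠ 0 := by
    have : g q = ((q.eval a : ℝ) : ℂ) := by
      have := Polynomial.aeval_algebraMap_apply_eq_algebraMap_eval (A := ℂ) a q
      simpa [g] using this
    rw [this]
    exact_mod_cast ha
  have h1 : S.rosenbrock (a : ℂ) * H.map g = g q • 1 := by
    have h2 := congrArg (fun M => M.map g) hqH
    rw [Matrix.map_mul, rosenbrock_map] at h2
    rw [show (a : ℂ) = g Polynomial.X by simp [g], h2]
    ext i j
    by_cases h : i = j <;> simp [h]
  have h2 : S.rosenbrock (a : ℂ) * ((g q)⁻¹ • H.map g) = 1 := by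
    rw [Matrix.mul_smul, h1, inv_smul_smul₀ hg]
  have h3 : n + p ≤ (S.rosenbrock (a : ℂ)).rank := by
    have := Matrix.rank_mul_le_left (S.rosenbrock (a : ℂ)) ((g q)⁻¹ • H.map g)
    rw [h2, Matrix.rank_one] at this
    simpa using this
  exact h3.trans (le_ciSup (f := fun z : ℂ => (S.rosenbrock z).rank)
    ⟨n + p, by rintro _ ⟨z, rfl⟩; exact S.rank_rosenbrock_le z⟩ (a : ℂ))

theorem rHat_nonempty (S : LTISystem n m p) (h : S.IsRightInvertible) {l : ℝ}
    (hl : (l : ℂ) ∉ S.invariantZeros) (j : Fin p) : (S.rHat j l).Nonempty := by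
  have hr : (S.rosenbrock (l : ℂ)).rank = Module.finrank ℂ ((Fin n ⊕ Fin p) → ℂ) := by
    refine le_antisymm ?_ ?_
    · simpa using S.rank_rosenbrock_le (l : ℂ)
    · simpa using (S.le_normalRank h).trans (not_lt.1 hl)
  have htop : LinearMap.range (S.rosenbrock (l : ℂ)).mulVecLin = ⊤ :=
    Submodule.eq_top_of_finrank_eq hr
  obtain ⟨u, hu⟩ := LinearMap.range_eq_top.1 htop
    (Sum.elim (0 : Fin n → ℂ) (Pi.single j 1))
  rw [Matrix.mulVecLin_apply, show (l : ℂ) = Algebra.ofId ℝ ℂ l from rfl, ← rosenbrock_map] at hu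
  refine ⟨fun i => (u (Sum.inl i)).re, 1, one_ne_zero, fun i => (u (Sum.inr i)).re, ?_⟩
  have hs : Sum.elim (fun i => (u (Sum.inl i)).re) (fun i => (u (Sum.inr i)).re) =
      fun k => (u k).re := by
    funext k; cases k <;> rfl
  rw [hs]
  funext i
  rw [← Matrix.re_map_ofReal_mulVec]
  refine (congrArg Complex.re (congrFun hu i)).trans ?_
  rcases i with i | i
  · simp
  · simp [Pi.single_apply, apply_ite]

end LTISystem

namespace LTISystem

variable {n m p : ℕ}

theorem exists_closedLoop_trajectory (S : LTISystem n m p) (F : Matrix (Fin m) (Fin n) ℝ)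
    (ξ : Fin n → ℝ) : ∃ x : ℝ → (Fin n → ℝ), x 0 = ξ ∧
      ∀ t, HasDerivAt x (S.closedLoop F (x t)) t := by
  let N : (Fin n → ℝ) →L[ℝ] (Fin n → ℝ) := LinearMap.toContinuousLinearMap (S.closedLoop F)
  refine ⟨fun t => NormedSpace.exp (t • N) ξ, by simp, fun t => ?_⟩
  exact (ContinuousLinearMap.apply ℝ (Fin n → ℝ) ξ).hasFDerivAt.comp_hasDerivAt t
    (hasDerivAt_exp_smul_const' N t)

theorem output_trackingInput_sub (S : LTISystem n m p) (F : Matrix (Fin m) (Fin n) ℝ)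
    (x xss : Fin n → ℝ) (uss : Fin m → ℝ) :
    S.C *ᵥ x + S.D *ᵥ trackingInput F xss uss x - (S.C *ᵥ xss + S.D *ᵥ uss) =
      S.closedLoopOutput F (x - xss) := by
  rw [closedLoopOutput_apply, trackingInput, Matrix.mulVec_add, Matrix.mulVec_sub S.C]
  abel

theorem state_trackingInput (S : LTISystem n m p) (F : Matrix (Fin m) (Fin n) ℝ)
    (x xss : Fin n → ℝ) (uss : Fin m → ℝ) :
    S.A *ᵥ x + S.B *ᵥ trackingInput F xss uss x =
      S.closedLoop F (x - xss) + (S.A *ᵥ xss + S.B *ᵥ uss) := by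
  rw [closedLoop_apply, trackingInput, Matrix.mulVec_add, Matrix.mulVec_sub S.A]
  abel

theorem eq_mul_exp_of_hasDerivWithinAt {f : ℝ → ℝ} {l : ℝ}
    (hf : ∀ t, 0 ≤ t → HasDerivWithinAt f (l * f t) (Set.Ici 0) t) {t : ℝ} (ht : 0 ≤ t) :
    f t = f 0 * Real.exp (l * t) := by
  have hg : ∀ s, 0 ≤ s → HasDerivWithinAt (fun s => f s * Real.exp (-(l * s))) 0
      (Set.Ici 0) s := by
    intro s hs
    have he : HasDerivAt (fun s : ℝ => Real.exp (-(l * s))) (Real.exp (-(l * s)) * -(l * 1)) s :=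
      ((hasDerivAt_id s).const_mul l).neg.exp
    exact ((hf s hs).mul he.hasDerivWithinAt).congr_deriv (by ring)
  have hconst := (convex_Ici (0 : ℝ)).is_const_of_fderivWithin_eq_zero (𝕜 := ℝ)
    (fun s hs => (hg s hs).differentiableWithinAt)
    (fun s hs => by
      have := (hg s hs).hasFDerivWithinAt.fderivWithin (uniqueDiffOn_Ici 0 s hs)
      rw [this]; ext; simp) (Set.self_mem_Ici) ht
  simp only [mul_zero, neg_zero, Real.exp_zero, mul_one] at hconst
  rw [hconst, mul_assoc, ← Real.exp_add, neg_add_cancel, Real.exp_zero, mul_one]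

theorem solvesMonotonicTracking_iff (S : LTISystem n m p) (τ : TimeDomain) (l : Fin p → ℝ)
    (F : Matrix (Fin m) (Fin n) ℝ) :
    S.SolvesMonotonicTracking τ l F ↔ τ.IsAsympStable (S.closedLoop F) ∧ ∀ x k,
      S.closedLoopOutput F (S.closedLoop F x) k = l k * S.closedLoopOutput F x k := by
  refine and_congr_right fun _ => ⟨?_, fun h => ⟨fun ξ => S.closedLoopOutput F ξ, ?_⟩⟩
  · rintro ⟨β, hβ⟩ ξ k
    have hss : S.IsSteadyState τ 0 0 0 := by cases τ <;> simp [IsSteadyState]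
    have hβ := hβ 0 0 0 hss
    have hin : ∀ x, S.C *ᵥ x + S.D *ᵥ trackingInput F 0 0 x - 0 = S.closedLoopOutput F x := by
      intro x
      have := S.output_trackingInput_sub F x 0 0
      simpa only [Matrix.mulVec_zero, add_zero, sub_zero] using this
    have hst : ∀ x, S.A *ᵥ x + S.B *ᵥ trackingInput F 0 0 x = S.closedLoop F x := by
      intro x
      have := S.state_trackingInput F x 0 0
      simpa only [Matrix.mulVec_zero, add_zero, sub_zero] using this
    cases τ with
    | continuous =>
      obtain ⟨x, hx0, hx⟩ := S.exists_closedLoop_trajectory F ξ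
      have hsol := hβ x fun t _ => by rw [hst]; exact (hx t).hasDerivWithinAt
      simp only [hin, sub_zero, hx0] at hsol
      have h0 := hsol 0 le_rfl k
      rw [hx0, mul_zero, Real.exp_zero, mul_one] at h0
      have hd1 : HasDerivWithinAt (fun t => S.closedLoopOutput F (x t) k)
          (S.closedLoopOutput F (S.closedLoop F ξ) k) (Set.Ici 0) 0 := by
        have h2 := (LinearMap.toContinuousLinearMap
          (S.closedLoopOutput F)).hasFDerivAt.comp_hasDerivAt (0 : ℝ) (hx 0)
        rw [hx0] at h2
        exact (hasDerivAt_pi.1 h2 k).hasDerivWithinAt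
      have hd2 : HasDerivWithinAt (fun t => S.closedLoopOutput F (x t) k)
          (l k * S.closedLoopOutput F ξ k) (Set.Ici 0) 0 := by
        have he : HasDerivAt (fun t : ℝ => β ξ k * Real.exp (l k * t))
            (β ξ k * (Real.exp (l k * 0) * (l k * 1))) 0 :=
          (((hasDerivAt_id (0 : ℝ)).const_mul (l k)).exp).const_mul _
        refine (he.hasDerivWithinAt.congr (fun t ht => hsol t ht k) (hsol 0 le_rfl k)).congr_deriv ?_
        rw [h0, mul_zero, Real.exp_zero]; ring
      exact (uniqueDiffOn_Ici (0 : ℝ) 0 Set.self_mem_Ici).eq_deriv _ hd1 hd2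
    | discrete =>
      have hsol := hβ (fun t => (S.closedLoop F ^ t) ξ) fun t => by
        rw [hst, pow_succ', Module.End.mul_apply]
      simp only [hin, sub_zero, pow_zero, Module.End.one_apply] at hsol
      have h0 := hsol 0 k
      have h1 := hsol 1 k
      simp only [pow_zero, pow_one, mul_one, Module.End.one_apply] at h0 h1
      rw [h1, h0, mul_comm]
  · intro r xss uss hss
    obtain ⟨hss, rfl⟩ := hss
    cases τ with
    | continuous =>
      intro x hx t ht k
      simp only [output_trackingInput_sub]
      refine eq_mul_exp_of_hasDerivWithinAt (f := fun t => S.closedLoopOutput F (x t - xss) k)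
        (fun s hs => ?_) ht
      have h1 := hx s hs
      rw [state_trackingInput, ← hss, add_zero] at h1
      have h2 := (LinearMap.toContinuousLinearMap
          (S.closedLoopOutput F)).hasFDerivAt.comp_hasDerivWithinAt s (h1.sub_const xss)
      rw [← h]
      exact hasDerivWithinAt_pi.1 h2 k
    | discrete =>
      intro x hx t k
      simp only [output_trackingInput_sub]
      induction t with
      | zero => simp
      | succ t ih =>
        rw [hx, state_trackingInput, ← hss, add_sub_cancel_right, h, ih, pow_succ]
        ring

end LTISystem

theorem mainTheorem2 {n m p : ℕ} (τ : TimeDomain) (S : LTISystem n m p)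
    -- the columns of `[B; D]` and the rows of `[C  D]` are linearly independent
    (hBD : LinearIndependent ℝ (Matrix.fromRows S.B S.D).col)
    (hCD : LinearIndependent ℝ (Matrix.fromCols S.C S.D).row)
    (hright : S.IsRightInvertible)
    (hstab : S.IsStabilisable τ)
    (hzero : τ.stepFrequency ∉ S.invariantZeros)
    (hdistinct : S.NoCoincidentMinPhaseZeros τ)
    (l : Fin p → ℝ) (hl : ∀ j, l j ∈ τ.visibleModes) :
    ((∀ j, (l j : ℂ) ∉ S.invariantZeros) →
      ((∃ F, S.SolvesMonotonicTracking τ l F) ↔ S.HasSpanningModes τ l)) ∧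
    (S.HasSpanningModes τ l ↔
      (∃ F, S.SolvesMonotonicTracking τ l F) ∧ ∀ j, (S.rHat j (l j)).Nonempty) := by
  have key : S.HasSpanningModes τ l ↔
      (∃ F, S.SolvesMonotonicTracking τ l F) ∧ ∀ j, (S.rHat j (l j)).Nonempty := by
    simp only [LTISystem.solvesMonotonicTracking_iff]
    constructor
    · intro h
      obtain ⟨v, hv, _⟩ := id h
      exact ⟨h.exists_feedback hl, fun j => ⟨v j, hv j⟩⟩
    · rintro ⟨⟨F, hF, hCF⟩, hne⟩
      exact LTISystem.hasSpanningModes_of_feedback hF hCF hne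
  refine ⟨fun hz => ?_, key⟩
  rw [key]
  exact (and_iff_left fun j => S.rHat_nonempty hright (hz j) j).symm
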